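/- For finite sets $A, B \subset \mathbb{R}$ write $A-B=\{a-b\}$, $xA=\{xa: a\in A\}$, $x+A=\{x+a : a\in A\}$, and $B^{-1}=\{b^{-1} : b\in B,\ b\neq 0\}$. For a nonempty finite $A\subset\mathbb{R}$ put $$d_*(A)=\min_{t>0}\ \min_{Q,R}\ \frac{|Q|^2|R|^2}{|A|\,t^3},\qquad d_+(A)=\min_{t>0}\ \min_{Q,R}\ \frac{|Q|^2|R|^2}{|A|\,t^3},$$ where $t$ is real and the inner minimum is over all nonempty finite sets $Q,R\subset\mathbb{R}\setminus\{0\}$ with $\max\{|Q|,|R|\}\ge|A|$ such that, for every $x\in A$, $|Q\cap xR^{-1}|\ge t$ (in the definition of $d_*$, where $0\notin A$), respectively $|Q\cap(x-R)|\ge t$ (in the definition of $d_+$). For $D>0$, a finite set $A\subset\mathbb{R}$ is of additive Szemerédi–Trotter type with parameter $D$ if $$|\{s\in A-B : |A\cap(B+s)|\ge\tau\}|\le \frac{D|A||B|^2}{\tau^3}$$ for every finite $B\subset\mathbb{R}$ and every real $\tau\ge1$, and of multiplicative Szemerédi–Trotter type with parameter $D$ if for all such $B$ and $\tau$ $$|\{s\in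 AB^{-1} : |A\cap sB|\ge\tau\}|\le \frac{D|A||B|^2}{\tau^3}.$$ **Lemma 19.** There are absolute constants $C,c>0$ such that the following holds for all finite sets $A,P\subset\mathbb{R}$ with $|A|\ge2$. (i) Put $\sigma_*=\sum_{x\in P}|A\cap xA|$. If $0\notin A$ and $\sigma_*>0$, then there is $A'\subseteq A$ such that $A'$ is of additive Szemerédi–Trotter type with parameter $C\,d_*(A')$, $$d_*(A')\le C(\log|A|)^c\,\frac{|P|^2|A|^2|A'|^2}{\sigma_*^3}\qquad\text{and}\qquad \frac{\sigma_*}{|P|}\le C(\log|A|)^c\,|A'|.$$ (ii) Put $\sigma_+=\sum_{x\in P}|A\cap(x+A)|$. If $\sigma_+>0$, then there is $A''\subseteq A$ such that $A''$ is of multiplicative Szemerédi–Trotter type with parameter $C\,d_+(A'')$, $$d_+(A'')\le C(\log|A|)^c\,\frac{|P|^2|A|^2|A''|^2}{\sigma_+^3}\qquad\text{and}\qquad \frac{\sigma_+}{|P|}\le C(\log|A|)^c\,|A''|.$$ -/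

import Mathlib

open scoped Pointwise

noncomputable section

namespace SumProduct

/-- `Sym_t^×(Q, R) = {x : |Q ∩ x R⁻¹| ≥ t}`. -/
def symMul (t : ℝ) (Q R : Finset ℝ) : Set ℝ :=
  {x | t ≤ ((Q ∩ x • R⁻¹).card : ℝ)}

/-- `Sym_t^+(Q, R) = {x : |Q ∩ (x - R)| ≥ t}`. -/
def symAdd (t : ℝ) (Q R : Finset ℝ) : Set ℝ :=
  {x | t ≤ ((Q ∩ ({x} - R)).card : ℝ)}

/-- The set of all quotients `|Q|² |R|² / (|A| t³)`, where `t > 0` is real and `Q`, `R` are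
nonempty finite sets of nonzero reals with `A ⊆ Sym_t^×(Q, R)` and `max (|Q|, |R|) ≥ |A|`. -/
def dMulValues (A : Finset ℝ) : Set ℝ :=
  {v | ∃ (t : ℝ) (Q R : Finset ℝ), 0 < t ∧ Q.Nonempty ∧ R.Nonempty ∧ 0 ∉ Q ∧ 0 ∉ R ∧
    (A : Set ℝ) ⊆ symMul t Q R ∧ A.card ≤ max Q.card R.card ∧
    v = (Q.card : ℝ) ^ 2 * (R.card : ℝ) ^ 2 / ((A.card : ℝ) * t ^ 3)}

/-- The set of all quotients `|Q|² |R|² / (|A| t³)`, where `t > 0` is real and `Q`, `R` are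
nonempty finite sets of nonzero reals with `A ⊆ Sym_t^+(Q, R)` and `max (|Q|, |R|) ≥ |A|`. -/
def dAddValues (A : Finset ℝ) : Set ℝ :=
  {v | ∃ (t : ℝ) (Q R : Finset ℝ), 0 < t ∧ Q.Nonempty ∧ R.Nonempty ∧ 0 ∉ Q ∧ 0 ∉ R ∧
    (A : Set ℝ) ⊆ symAdd t Q R ∧ A.card ≤ max Q.card R.card ∧
    v = (Q.card : ℝ) ^ 2 * (R.card : ℝ) ^ 2 / ((A.card : ℝ) * t ^ 3)}

/-- `d_*(A)`, for a nonempty finite set `A` of nonzero reals (otherwise a junk value: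
there are no admissible `Q`, `R`, `t` if `0 ∈ A`). -/
def dMul (A : Finset ℝ) : ℝ := sInf (dMulValues A)

/-- `d_+(A)`, for a nonempty finite set `A` of reals. -/
def dAdd (A : Finset ℝ) : ℝ := sInf (dAddValues A)

/-- `A` is of (additive) Szemerédi–Trotter type with parameter `D > 0`: for every finite `B ⊂ ℝ`
and every real `τ ≥ 1`, `|{s ∈ A - B : |A ∩ (B + s)| ≥ τ}| ≤ D |A| |B|² / τ³`. -/
def IsSzTAdd (A : Finset ℝ) (D : ℝ) : Prop :=
  0 < D ∧ ∀ (B : Finset ℝ) (τ : ℝ), 1 ≤ τ →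
    (((A - B).filter fun s => τ ≤ ((A ∩ (s +ᵥ B)).card : ℝ)).card : ℝ) ≤
      D * (A.card : ℝ) * (B.card : ℝ) ^ 2 / τ ^ 3

/-- `A` is of multiplicative Szemerédi–Trotter type with parameter `D > 0`: for every finite
`B ⊂ ℝ` and every real `τ ≥ 1`, `|{s ∈ A B⁻¹ : |A ∩ s B| ≥ τ}| ≤ D |A| |B|² / τ³`. Here `B⁻¹` is
the set of the inverses of the nonzero elements of `B`. -/
def IsSzTMul (A : Finset ℝ) (D : ℝ) : Prop :=
  0 < D ∧ ∀ (B : Finset ℝ) (τ : ℝ), 1 ≤ τ →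
    (((A * (B.erase 0)⁻¹).filter fun s => τ ≤ ((A ∩ s • B).card : ℝ)).card : ℝ) ≤
      D * (A.card : ℝ) * (B.card : ℝ) ^ 2 / τ ^ 3

/-- `σ_* = ∑_{x ∈ P} |A ∩ xA|`. -/
def sigmaMul (A P : Finset ℝ) : ℕ := ∑ x ∈ P, (A ∩ x • A).card

/-- `σ_+ = ∑_{x ∈ P} |A ∩ (x + A)|`. -/
def sigmaAdd (A P : Finset ℝ) : ℕ := ∑ x ∈ P, (A ∩ (x +ᵥ A)).card

end SumProduct

end

/-!
If every `a ∈ A` has at least `t` representations `a = q r` with `q ∈ Q`, `r ∈ R`, then every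
translate `s + B` which meets `A` in at least `τ` points yields `τ t` solutions of `q r = s + b`,
that is, incidences between the points `(q, b)` of a grid and the lines with slope `r` and
intercept `-s`. The Szemerédi–Trotter bound for these incidences limits the number of such `s`.
Sums `a = q + r` and dilates `s B` behave in the same way, with the equation `q + r = s b`.

For a grid the Szemerédi–Trotter bound is elementary. Cut both sides of the grid into blocks. By
monotonicity a line passes through few of the resulting cells, and two points of the same cell lie
on at most one common line.

Finally, `σ_*` is the sum over `a ∈ A` of the number of representations `a = x a'` with `x ∈ P` and
`a' ∈ A`. Some level set `A'` of this function carries the whole sum up to a logarithm, and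
`Q = P`, `R = A` are then admissible in the definition of `d_*(A')`; likewise for `σ_+`.
-/

namespace SumProduct

open Finset Function

section Blocks

variable {α : Type*} [LinearOrder α]

theorem monotone_card_filter_lt (X : Finset α) : Monotone fun x => #{z ∈ X | z < x} :=
  fun _ _ hxy => card_le_card (monotone_filter_right X fun _ _ hz => hz.trans_le hxy)

theorem strictMonoOn_card_filter_lt (X : Finset α) :
    StrictMonoOn (fun x => #{z ∈ X | z < x}) X := by
  intro x hx y _ hxy
  refine card_lt_card ((ssubset_iff_of_subset ?_).2 ⟨x, by simpa [hxy] using hx, by simp⟩)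
  exact monotone_filter_right X fun _ _ hz => hz.trans hxy

theorem exists_monotone_blocks (X : Finset α) {w : ℕ} (hw : 0 < w) :
    ∃ f : α → ℕ, Monotone f ∧ (∀ x, f x ≤ #X / w) ∧ ∀ j, #{x ∈ X | f x = j} ≤ w := by
  let rank (x : α) : ℕ := #{z ∈ X | z < x}
  refine ⟨fun x => rank x / w, fun x y h => Nat.div_le_div_right (monotone_card_filter_lt X h),
    fun x => Nat.div_le_div_right (card_filter_le _ _), fun j => ?_⟩
  calc #{x ∈ X | rank x / w = j}
    _ ≤ #(Ico (j * w) (j * w + w)) := by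
      refine card_le_card_of_injOn rank (fun x hx => ?_)
        ((strictMonoOn_card_filter_lt X).injOn.mono (coe_subset.2 (filter_subset _ _)))
      obtain ⟨hle, hlt⟩ := (Nat.div_eq_iff hw).1 (mem_filter.1 hx).2
      simp only [coe_Ico, Set.mem_Ico]
      omega
    _ = w := by simp

theorem card_image_prodMk_le_of_monotone {f h : α → ℕ} (hf : Monotone f) (hh : Monotone h)
    {r s : ℕ} (hr : ∀ x, f x ≤ r) (hs : ∀ x, h x ≤ s) (T : Finset α) :
    #(T.image fun x => (f x, h x)) ≤ r + s + 1 := by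
  rw [← card_range (r + s + 1)]
  refine card_le_card_of_injOn (fun c => c.1 + c.2) ?_ ?_
  · intro c hc
    obtain ⟨x, -, rfl⟩ := mem_image.1 hc
    have := hr x
    have := hs x
    simp only [coe_range, Set.mem_Iio]
    omega
  · intro c hc d hd hcd
    obtain ⟨x, -, rfl⟩ := mem_image.1 hc
    obtain ⟨y, -, rfl⟩ := mem_image.1 hd
    simp only [Prod.mk.injEq] at hcd ⊢
    rcases le_total x y with hxy | hxy <;>
    · have := hf hxy
      have := hh hxy
      omega

theorem card_image_prodMk_le {f h : α → ℕ} (hf : Monotone f) (hh : Monotone h ∨ Antitone h)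
    {r s : ℕ} (hr : ∀ x, f x ≤ r) (hs : ∀ x, h x ≤ s) (T : Finset α) :
    #(T.image fun x => (f x, h x)) ≤ r + s + 1 := by
  rcases hh with hh | hh
  · exact card_image_prodMk_le_of_monotone hf hh hr hs T
  · have hflip : T.image (fun x => (f x, h x)) =
        (T.image fun x => (f x, s - h x)).image fun c => (c.1, s - c.2) := by
      simp only [image_image, comp_def, Nat.sub_sub_self (hs _)]
    rw [hflip]
    exact card_image_le.trans (card_image_prodMk_le_of_monotone hf
      (fun _ _ hxy => Nat.sub_le_sub_left (hh hxy) s) hr (fun _ => Nat.sub_le _ _) T)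

end Blocks

theorem card_pairs_same_block_le {α : Type*} {f : α → ℕ} {X : Finset α} {w : ℕ}
    (hf : ∀ j, #{x ∈ X | f x = j} ≤ w) : #{p ∈ X ×ˢ X | f p.1 = f p.2} ≤ #X * w := by
  rw [card_filter, sum_product, ← smul_eq_mul]
  refine sum_le_card_nsmul _ _ _ fun x _ => ?_
  rw [← card_filter]
  simpa only [eq_comm] using hf (f x)

theorem card_le_card_image_add_card_collisions {α β : Type*} [DecidableEq β] (T : Finset α)
    (c : α → β) : #T ≤ #(T.image c) + #{p ∈ T.offDiag | c p.1 = c p.2} := by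
  classical
  obtain ⟨U, hUT, hinj, himage⟩ := exists_subset_injOn_image_eq_of_surjOn (f := c) (s := T)
    (T.image c) (by simpa using Set.surjOn_image c T)
  have hcover : T ⊆ U ∪ {p ∈ T.offDiag | c p.1 = c p.2}.image Prod.fst := by
    intro x hx
    by_cases hxU : x ∈ U
    · exact mem_union_left _ hxU
    obtain ⟨u, hu, hux⟩ := mem_image.1 (himage ▸ mem_image_of_mem c hx)
    refine mem_union_right _ (mem_image.2 ⟨(x, u), ?_, rfl⟩)
    exact mem_filter.2 ⟨mem_offDiag.2 ⟨hx, hUT hu, fun h : x = u => hxU (h ▸ hu)⟩, hux.symm⟩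
  calc #T ≤ #U + #({p ∈ T.offDiag | c p.1 = c p.2}.image Prod.fst) :=
        (card_le_card hcover).trans (card_union_le _ _)
    _ ≤ _ := by
      rw [← himage, card_image_of_injOn hinj]
      exact Nat.add_le_add_left card_image_le _

section Pseudolines

variable {ι α β : Type*}

/-- A family of functions whose graphs behave like non-vertical lines: each graph is monotone or
antitone, and two points with distinct abscissae lie on at most one of them. -/
structure IsPseudolineFamily [Preorder α] [Preorder β] (φ : ι → α → β) : Prop where
  monotone_or_antitone (l : ι) : Monotone (φ l) ∨ Antitone (φ l)
  injective_of_ne {x y : α} : x ≠ y → Injective fun l => (φ l x, φ l y)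

/-- The incidences between the grid `X × Y` and the graphs of `φ l` for `l ∈ L`. An incidence is
recorded as `(l, x)`, since its ordinate is `φ l x`. -/
def gridIncidences [DecidableEq β] (φ : ι → α → β) (L : Finset ι) (X : Finset α) (Y : Finset β) :
    Finset (ι × α) :=
  {p ∈ L ×ˢ X | φ p.1 p.2 ∈ Y}

theorem card_gridIncidences [DecidableEq β] (φ : ι → α → β) (L : Finset ι) (X : Finset α)
    (Y : Finset β) : #(gridIncidences φ L X Y) = ∑ l ∈ L, #{x ∈ X | φ l x ∈ Y} := by
  simp only [gridIncidences, card_filter, sum_product]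

variable [LinearOrder α] [LinearOrder β]

namespace IsPseudolineFamily

variable {φ : ι → α → β}

theorem sum_card_collisions_le (hφ : IsPseudolineFamily φ) {f : α → ℕ} {g : β → ℕ}
    (L : Finset ι) {X : Finset α} {Y : Finset β} {u v : ℕ} (hf : ∀ j, #{x ∈ X | f x = j} ≤ u)
    (hg : ∀ j, #{y ∈ Y | g y = j} ≤ v) :
    ∑ l ∈ L, #{p ∈ {x ∈ X | φ l x ∈ Y}.offDiag |
      (f p.1, g (φ l p.1)) = (f p.2, g (φ l p.2))} ≤ #X * u * (#Y * v) := by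
  rw [← card_sigma]
  refine le_trans ?_ (Nat.mul_le_mul (card_pairs_same_block_le hf) (card_pairs_same_block_le hg))
  rw [← card_product]
  refine card_le_card_of_injOn (fun p => (p.2, (φ p.1 p.2.1, φ p.1 p.2.2))) ?_ ?_
  · rintro ⟨l, p⟩ hp
    simp only [coe_sigma, Set.mem_sigma_iff, mem_coe, mem_filter, mem_offDiag,
      mem_product, Prod.mk.injEq] at hp ⊢
    tauto
  · rintro ⟨l, p⟩ hp ⟨l', p'⟩ - h
    simp only [coe_sigma, Set.mem_sigma_iff, mem_coe, mem_filter, mem_offDiag] at hp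
    obtain ⟨rfl, hl⟩ := Prod.mk.inj h
    obtain rfl : l = l' := hφ.injective_of_ne hp.2.1.2.2 hl
    rfl

theorem card_gridIncidences_le (hφ : IsPseudolineFamily φ) (L : Finset ι) (X : Finset α)
    (Y : Finset β) {u v : ℕ} (hu : 0 < u) (hv : 0 < v) :
    #(gridIncidences φ L X Y) ≤ #L * (#X / u + #Y / v + 1) + #X * u * (#Y * v) := by
  obtain ⟨f, hf, hfX, hfu⟩ := exists_monotone_blocks X hu
  obtain ⟨g, hg, hgY, hgv⟩ := exists_monotone_blocks Y hv
  have hcells (l : ι) (T : Finset α) :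
      #(T.image fun x => (f x, g (φ l x))) ≤ #X / u + #Y / v + 1 :=
    card_image_prodMk_le hf ((hφ.monotone_or_antitone l).imp hg.comp hg.comp_antitone) hfX
      (fun _ => hgY _) T
  rw [card_gridIncidences, ← smul_eq_mul (#L), ← sum_const]
  refine le_trans ?_ (Nat.add_le_add_left (hφ.sum_card_collisions_le L hfu hgv) _)
  rw [← sum_add_distrib]
  exact sum_le_sum fun l _ =>
    (card_le_card_image_add_card_collisions _ fun x => (f x, g (φ l x))).trans
      (Nat.add_le_add_right (hcells l _) _)

end IsPseudolineFamily

theorem exists_block_width {x r : ℝ} (hr : 0 < r) (hrx : r ≤ x) :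
    ∃ u : ℕ, 0 < u ∧ x / u ≤ r / 4 ∧ (u : ℝ) ≤ 5 * (x / r) := by
  have hxr : 1 ≤ x / r := (one_le_div hr).2 hrx
  have hu : 0 < ⌈4 * (x / r)⌉₊ := Nat.ceil_pos.2 (by linarith)
  have hu' : (0 : ℝ) < ⌈4 * (x / r)⌉₊ := Nat.cast_pos.2 hu
  refine ⟨⌈4 * (x / r)⌉₊, hu, ?_, ?_⟩
  · rw [div_le_iff₀ hu']
    calc x = r / 4 * (4 * (x / r)) := by field_simp
      _ ≤ r / 4 * ⌈4 * (x / r)⌉₊ := by gcongr; exact Nat.le_ceil _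
  · linarith [Nat.ceil_lt_add_one (show 0 ≤ 4 * (x / r) by linarith)]

-- The blocks are so wide that every graph meets at most `3 r / 4` cells, hence at least a quarter
-- of the incidences are accounted for by pairs of points in a common cell.
theorem IsPseudolineFamily.card_mul_pow_three_le {φ : ι → α → β} (hφ : IsPseudolineFamily φ)
    {L : Finset ι} {X : Finset α} {Y : Finset β} {r : ℝ} (hr : 4 ≤ r) (hX : r ≤ #X)
    (hY : r ≤ #Y) (hrich : #L * r ≤ #(gridIncidences φ L X Y)) :
    #L * r ^ 3 ≤ 100 * ((#X : ℝ) ^ 2 * (#Y : ℝ) ^ 2) := by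
  have hr0 : 0 < r := by linarith
  obtain ⟨u, hu, hXu, hur⟩ := exists_block_width hr0 hX
  obtain ⟨v, hv, hYv, hvr⟩ := exists_block_width hr0 hY
  have hcells : #L * r ≤ #L * (3 / 4 * r) + 25 * ((#X : ℝ) ^ 2 * (#Y : ℝ) ^ 2) / r ^ 2 := by
    calc #L * r ≤ #(gridIncidences φ L X Y) := hrich
      _ ≤ #L * (((#X / u : ℕ) : ℝ) + ((#Y / v : ℕ) : ℝ) + 1) + #X * u * (#Y * v) := by
        exact_mod_cast hφ.card_gridIncidences_le L X Y hu hv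
      _ ≤ #L * ((#X : ℝ) / u + (#Y : ℝ) / v + 1) + #X * u * (#Y * v) := by
        gcongr <;> exact Nat.cast_div_le
      _ ≤ #L * (r / 4 + r / 4 + r / 4) + #X * (5 * (#X / r)) * (#Y * (5 * (#Y / r))) := by
        gcongr
        linarith
      _ = _ := by ring
  have hquarter : #L * r / 4 ≤ 25 * ((#X : ℝ) ^ 2 * (#Y : ℝ) ^ 2) / r ^ 2 := by linarith
  rw [le_div_iff₀ (by positivity)] at hquarter
  linarith

end Pseudolines

theorem isPseudolineFamily_line {R : Type*} [Ring R] [LinearOrder R] [IsStrictOrderedRing R] :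
    IsPseudolineFamily fun (l : R × R) (x : R) => l.1 * x - l.2 where
  monotone_or_antitone l := by
    rcases le_total 0 l.1 with hm | hm
    · exact .inl fun _ _ hxy => sub_le_sub_right (mul_le_mul_of_nonneg_left hxy hm) _
    · exact .inr fun _ _ hxy => sub_le_sub_right (mul_le_mul_of_nonpos_left hxy hm) _
  injective_of_ne {x x'} hne := by
    rintro ⟨m, k⟩ ⟨m', k'⟩ h
    obtain ⟨hx, hx'⟩ := Prod.mk.inj h
    have hslope : m * (x - x') = m' * (x - x') := by
      simpa [mul_sub] using congrArg₂ (· - ·) hx hx'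
    obtain rfl : m = m' := mul_right_cancel₀ (sub_ne_zero.2 hne) hslope
    simpa using hx

section Representations

variable {α β γ δ ε : Type*} [DecidableEq ε]

/-- The number of representations `c = f q r` with `q ∈ Q` and `r ∈ R`. For a general operation `f`
it plays the role of a convolution of the indicator functions of `Q` and `R`. -/
def repCount (f : α → β → ε) (Q : Finset α) (R : Finset β) (c : ε) : ℕ :=
  #{p ∈ Q ×ˢ R | f p.1 p.2 = c}

variable {f : α → β → ε} {Q : Finset α} {R : Finset β} {c : ε}

theorem repCount_flip (f : α → β → ε) (Q : Finset α) (R : Finset β) (c : ε) :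
    repCount (flip f) R Q c = repCount f Q R c := by
  unfold repCount
  refine card_nbij' Prod.swap Prod.swap ?_ ?_ (fun _ _ => rfl) (fun _ _ => rfl) <;>
  · rintro ⟨x, y⟩ h
    simp only [coe_filter, mem_product, Set.mem_ofPred_eq] at h ⊢
    exact ⟨h.1.symm, h.2⟩

theorem repCount_le_card_left (hf : ∀ q ∈ Q, Set.InjOn (f q) R) : repCount f Q R c ≤ #Q := by
  refine card_le_card_of_injOn Prod.fst (fun p hp => (mem_product.1 (mem_filter.1 hp).1).1) ?_
  rintro ⟨q, r⟩ hp ⟨q', r'⟩ hp' (rfl : q = q')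
  simp only [coe_filter, mem_product, Set.mem_ofPred_eq] at hp hp'
  rw [hf q hp.1.1 hp.1.2 hp'.1.2 (hp.2.trans hp'.2.symm)]

theorem repCount_le_card_right (hf : ∀ r ∈ R, Set.InjOn (f · r) Q) : repCount f Q R c ≤ #R := by
  rw [← repCount_flip]
  exact repCount_le_card_left hf

theorem repCount_eq_card_inter_image [DecidableEq α] {h : β → α}
    (hf : ∀ q ∈ Q, Set.InjOn (f q) R) (hh : ∀ q ∈ Q, ∀ r ∈ R, f q r = c ↔ h r = q) :
    repCount f Q R c = #(Q ∩ R.image h) := by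
  have hfst : Q ∩ R.image h = {p ∈ Q ×ˢ R | f p.1 p.2 = c}.image Prod.fst := by
    ext q
    simp only [mem_inter, mem_image, mem_filter, mem_product, Prod.exists]
    grind
  rw [hfst, card_image_of_injOn, repCount]
  rintro ⟨q, r⟩ hp ⟨q', r'⟩ hp' (rfl : q = q')
  simp only [coe_filter, mem_product, Set.mem_ofPred_eq] at hp hp'
  rw [hf q hp.1.1 hp.1.2 hp'.1.2 (hp.2.trans hp'.2.symm)]

theorem card_inter_image_le (A : Finset ε) (B : Finset β) (h : β → ε) :
    #(A ∩ B.image h) ≤ #{b ∈ B | h b ∈ A} := by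
  rw [inter_comm, ← filter_mem_eq_inter, filter_image]
  exact card_image_le

theorem card_inter_image_of_injOn {A : Finset ε} {B : Finset β} {h : β → ε} (hh : Set.InjOn h B) :
    #(A ∩ B.image h) = #{b ∈ B | h b ∈ A} := by
  rw [inter_comm, ← filter_mem_eq_inter, filter_image]
  exact card_image_of_injOn (hh.mono (coe_subset.2 (filter_subset _ _)))

theorem repCount_image [DecidableEq α] [DecidableEq β] {α' β' : Type*} {f' : α' → β' → ε}
    {φ : α' → α} {ψ : β' → β} (hφ : Injective φ) (hψ : Injective ψ)
    (h : ∀ q r, f (φ q) (ψ r) = f' q r) (Q : Finset α') (R : Finset β') :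
    repCount f (Q.image φ) (R.image ψ) c = repCount f' Q R c := by
  simp only [repCount, ← prodMap_image_product, filter_image, Prod.map_fst, Prod.map_snd, h]
  exact card_image_of_injective _ (hφ.prodMap hψ)

theorem sum_repCount (f : α → β → ε) (Q : Finset α) (R : Finset β) (A : Finset ε) :
    ∑ a ∈ A, repCount f Q R a = ∑ q ∈ Q, #{r ∈ R | f q r ∈ A} := by
  simp only [repCount, card_filter]
  rw [sum_comm, sum_product]
  simp

theorem sum_card_inter_image_eq_sum_repCount {A : Finset ε} (hf : ∀ q ∈ Q, Set.InjOn (f q) R) :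
    ∑ q ∈ Q, #(A ∩ R.image (f q)) = ∑ a ∈ A, repCount f Q R a := by
  rw [sum_repCount]
  exact sum_congr rfl fun q hq => card_inter_image_of_injOn (hf q hq)

theorem sum_card_inter_image_le (A : Finset ε) (hf : ∀ r ∈ R, Set.InjOn (f · r) Q) :
    ∑ q ∈ Q, #(A ∩ R.image (f q)) ≤ #A * #R :=
  calc ∑ q ∈ Q, #(A ∩ R.image (f q))
    _ ≤ ∑ a ∈ A, repCount f Q R a := by
      rw [sum_repCount]
      exact sum_le_sum fun q _ => card_inter_image_le _ _ _
    _ ≤ #A * #R := sum_le_card_nsmul _ _ _ fun _ _ => repCount_le_card_right hf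

theorem card_mul_le_of_rich {A : Finset ε} {τ : ℝ} (hf : ∀ r ∈ R, Set.InjOn (f · r) Q)
    (hrich : ∀ q ∈ Q, τ ≤ #(A ∩ R.image (f q))) : #Q * τ ≤ #A * #R :=
  calc #Q * τ ≤ ∑ q ∈ Q, (#(A ∩ R.image (f q)) : ℝ) := by
        rw [← nsmul_eq_mul]
        exact card_nsmul_le_sum _ _ _ hrich
    _ ≤ #A * #R := by exact_mod_cast sum_card_inter_image_le A hf

theorem card_inter_image_le_card_inter_image_erase_add_one [DecidableEq β] (A : Finset ε)
    (B : Finset β) (h : β → ε) (b : β) :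
    #(A ∩ B.image h) ≤ #(A ∩ (B.erase b).image h) + 1 := by
  refine (card_le_card fun x hx => ?_).trans (card_insert_le (h b) _)
  simp only [mem_inter, mem_image, mem_insert, mem_erase] at hx ⊢
  grind

-- The map `s ↦ s * b` is injective only for `b ≠ 0`. Dropping `0` from `B` costs at most one
-- element of each intersection, in total at most `|S| ≤ |A| |B|`.
theorem card_mul_le_of_rich_dilates {G : Type*} [GroupWithZero G] [DecidableEq G] {A B S : Finset G}
    {τ : ℝ} (hS : S ⊆ A * (B.erase 0)⁻¹) (hrich : ∀ s ∈ S, τ ≤ #(A ∩ B.image (s * ·))) :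
    #S * τ ≤ 2 * (#A * #B) := by
  have hquot : (#S : ℝ) ≤ #A * #(B.erase 0) := by
    have := (card_le_card hS).trans card_mul_le
    rw [card_inv] at this
    exact_mod_cast this
  have herase : #S * (τ - 1) ≤ #A * #(B.erase 0) := by
    refine card_mul_le_of_rich
      (fun b hb => (mul_left_injective₀ (ne_of_mem_erase hb)).injOn) fun s hs => ?_
    rw [sub_le_iff_le_add]
    exact (hrich s hs).trans
      (by exact_mod_cast card_inter_image_le_card_inter_image_erase_add_one A B (s * ·) 0)
  calc #S * τ = #S * (τ - 1) + #S := by ring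
    _ ≤ 2 * (#A * #(B.erase 0)) := by linarith
    _ ≤ 2 * (#A * #B) := by
      gcongr
      exact erase_subset 0 B

/-- The solutions `((q, r), (s, b))` of the equation `f q r = g s b`. -/
def solutions (f : α → β → ε) (g : γ → δ → ε) (Q : Finset α) (R : Finset β) (S : Finset γ)
    (B : Finset δ) : Finset ((α × β) × (γ × δ)) :=
  {p ∈ (Q ×ˢ R) ×ˢ (S ×ˢ B) | f p.1.1 p.1.2 = g p.2.1 p.2.2}

theorem card_solutions (f : α → β → ε) (g : γ → δ → ε) (Q : Finset α) (R : Finset β)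
    (S : Finset γ) (B : Finset δ) :
    #(solutions f g Q R S B) = ∑ s ∈ S, ∑ b ∈ B, repCount f Q R (g s b) := by
  simp only [solutions, repCount, card_filter]
  rw [sum_product_right, sum_product]

theorem mul_le_card_solutions {g : γ → δ → ε} {S : Finset γ} {B : Finset δ} {A : Finset ε}
    {τ t : ℝ} (ht : 0 ≤ t) (hA : ∀ a ∈ A, t ≤ repCount f Q R a)
    (hS : ∀ s ∈ S, τ ≤ #{b ∈ B | g s b ∈ A}) :
    #S * (τ * t) ≤ #(solutions f g Q R S B) := by
  rw [card_solutions, Nat.cast_sum, ← nsmul_eq_mul]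
  refine card_nsmul_le_sum _ _ _ fun s hs => ?_
  calc τ * t ≤ #{b ∈ B | g s b ∈ A} * t := by gcongr; exact hS s hs
    _ ≤ ∑ b ∈ B with g s b ∈ A, (repCount f Q R (g s b) : ℝ) := by
      rw [← nsmul_eq_mul]
      exact card_nsmul_le_sum _ _ _ fun b hb => hA _ (mem_filter.1 hb).2
    _ ≤ ((∑ b ∈ B, repCount f Q R (g s b) : ℕ) : ℝ) := by
      exact_mod_cast sum_le_sum_of_subset (filter_subset _ _)

/-- A Szemerédi–Trotter bound for the equation `f q r = g s b`, seen as an incidence between the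
point `(q, b)` of the grid `Q × B` and the curve with parameters `(s, r)`: if these curves carry
at least `k` points on average, then there are `O(|Q|² |B|² / k³)` of them. -/
def HasSzTBound (f : α → β → ε) (g : γ → δ → ε) : Prop :=
  ∀ ⦃Q : Finset α⦄ ⦃R : Finset β⦄ ⦃S : Finset γ⦄ ⦃B : Finset δ⦄ ⦃k : ℝ⦄, 4 ≤ k → k ≤ #Q →
    k ≤ #B → #S * #R * k ≤ #(solutions f g Q R S B) →
    #S * #R * k ^ 3 ≤ 100 * ((#Q : ℝ) ^ 2 * (#B : ℝ) ^ 2)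

end Representations

section Equations

variable {K : Type*} [CommRing K] [LinearOrder K] [IsStrictOrderedRing K]

theorem hasSzTBound_mul_add : HasSzTBound (fun q r : K => q * r) fun s b : K => s + b := by
  intro Q R S B k hk hQ hB hsol
  have hle : #(solutions (fun q r : K => q * r) (fun s b : K => s + b) Q R S B) ≤
      #(gridIncidences (fun (l : K × K) x => l.1 * x - l.2) (R ×ˢ S) Q B) := by
    refine card_le_card_of_injOn (fun p => ((p.1.2, p.2.1), p.1.1)) ?_ ?_
    · rintro ⟨⟨q, r⟩, ⟨s, b⟩⟩ hp
      simp only [solutions, gridIncidences, coe_filter, mem_product, Set.mem_ofPred_eq] at hp ⊢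
      obtain ⟨⟨⟨hq, hr⟩, hs, hb⟩, h⟩ := hp
      exact ⟨⟨⟨hr, hs⟩, hq⟩, by rwa [mul_comm, h, add_sub_cancel_left]⟩
    · rintro ⟨⟨q, r⟩, ⟨s, b⟩⟩ hp ⟨⟨q', r'⟩, ⟨s', b'⟩⟩ hp' h
      simp only [solutions, coe_filter, Set.mem_ofPred_eq] at hp hp'
      simp only [Prod.mk.injEq] at h
      grind
  have := isPseudolineFamily_line.card_mul_pow_three_le (L := R ×ˢ S) hk hQ hB (by
    rw [card_product, mul_comm (#R), Nat.cast_mul]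
    exact hsol.trans (Nat.cast_le.2 hle))
  rwa [card_product, mul_comm (#R), Nat.cast_mul] at this

theorem hasSzTBound_add_mul : HasSzTBound (fun q r : K => q + r) fun s b : K => s * b := by
  intro Q R S B k hk hQ hB hsol
  have hle : #(solutions (fun q r : K => q + r) (fun s b : K => s * b) Q R S B) ≤
      #(gridIncidences (fun (l : K × K) x => l.1 * x - l.2) (S ×ˢ R) B Q) := by
    refine card_le_card_of_injOn (fun p => ((p.2.1, p.1.2), p.2.2)) ?_ ?_
    · rintro ⟨⟨q, r⟩, ⟨s, b⟩⟩ hp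
      simp only [solutions, gridIncidences, coe_filter, mem_product, Set.mem_ofPred_eq] at hp ⊢
      obtain ⟨⟨⟨hq, hr⟩, hs, hb⟩, h⟩ := hp
      exact ⟨⟨⟨hs, hr⟩, hb⟩, by rwa [← h, add_sub_cancel_right]⟩
    · rintro ⟨⟨q, r⟩, ⟨s, b⟩⟩ hp ⟨⟨q', r'⟩, ⟨s', b'⟩⟩ hp' h
      simp only [solutions, coe_filter, Set.mem_ofPred_eq] at hp hp'
      simp only [Prod.mk.injEq] at h
      grind
  have := isPseudolineFamily_line.card_mul_pow_three_le (L := S ×ˢ R) hk hB hQ (by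
    rw [card_product, Nat.cast_mul]
    exact hsol.trans (Nat.cast_le.2 hle))
  rwa [card_product, Nat.cast_mul, mul_comm ((#B : ℝ) ^ 2)] at this

end Equations

section RichElements

variable {α β γ δ ε : Type*} [DecidableEq ε] {f : α → β → ε} {g : γ → δ → ε}

theorem HasSzTBound.card_mul_pow_three_le_of_card_le_left (hfg : HasSzTBound f g) {A : Finset ε}
    {Q : Finset α} {R : Finset β} {S : Finset γ} {B : Finset δ} {t τ : ℝ} (ht : 0 < t)
    (hτ : 0 < τ) (htQ : t ≤ #Q) (htR : t ≤ #R) (hAQ : #A ≤ #Q)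
    (hrep : ∀ a ∈ A, t ≤ repCount f Q R a) (hrich : ∀ s ∈ S, τ ≤ #(A ∩ B.image (g s)))
    (hpairs : #S * τ ≤ 2 * (#A * #B)) :
    #S * τ ^ 3 * t ^ 3 ≤ 100 * ((#Q : ℝ) ^ 2 * (#R : ℝ) ^ 2 * (#B : ℝ) ^ 2) := by
  rcases S.eq_empty_or_nonempty with rfl | ⟨s, hs⟩
  · simp only [card_empty, Nat.cast_zero, zero_mul]
    positivity
  have hτA : τ ≤ #A := (hrich s hs).trans (Nat.cast_le.2 (card_le_card inter_subset_left))
  have hτB : τ ≤ #B := (hrich s hs).trans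
    (Nat.cast_le.2 ((card_le_card inter_subset_right).trans card_image_le))
  have hR : (0 : ℝ) < #R := ht.trans_le htR
  rcases lt_or_ge (τ * t) (4 * #R) with hpoor | hpopular
  · have hB : (1 : ℝ) ≤ #B := by exact_mod_cast Nat.cast_pos.1 (hτ.trans_le hτB)
    calc (#S : ℝ) * τ ^ 3 * t ^ 3 = #S * τ * (τ * t) ^ 2 * t := by ring
      _ ≤ 2 * (#A * #B) * (4 * #R : ℝ) ^ 2 * #Q := mul_le_mul
        (mul_le_mul hpairs (by gcongr) (by positivity) (by positivity)) htQ ht.le (by positivity)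
      _ ≤ 2 * (#Q * #B) * (4 * #R : ℝ) ^ 2 * #Q := by gcongr
      _ = 32 * ((#Q : ℝ) ^ 2 * (#R : ℝ) ^ 2 * (#B * 1)) := by ring
      _ ≤ 100 * ((#Q : ℝ) ^ 2 * (#R : ℝ) ^ 2 * (#B * #B)) := by
        gcongr
        norm_num
      _ = _ := by ring
  · have hkτ : τ * t / #R ≤ τ := by
      rw [div_le_iff₀ hR]
      gcongr
    have hsol : #S * #R * (τ * t / #R) ≤ #(solutions f g Q R S B) := by
      rw [mul_assoc, mul_div_cancel₀ _ hR.ne']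
      exact mul_le_card_solutions ht.le hrep fun s hs =>
        (hrich s hs).trans (Nat.cast_le.2 (card_inter_image_le _ _ _))
    have hbound := hfg ((le_div_iff₀ hR).2 hpopular)
      (hkτ.trans (hτA.trans (Nat.cast_le.2 hAQ))) (hkτ.trans hτB) hsol
    calc (#S : ℝ) * τ ^ 3 * t ^ 3 = #S * #R * (τ * t / #R) ^ 3 * (#R : ℝ) ^ 2 := by field_simp
      _ ≤ 100 * ((#Q : ℝ) ^ 2 * (#B : ℝ) ^ 2) * (#R : ℝ) ^ 2 := by gcongr
      _ = _ := by ring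

theorem HasSzTBound.card_mul_pow_three_le {f : α → α → ε} (hfg : HasSzTBound f g)
    (hf : ∀ q r, f q r = f r q) {A : Finset ε} {Q R : Finset α} {S : Finset γ} {B : Finset δ}
    {t τ : ℝ} (ht : 0 < t) (hτ : 0 < τ) (htQ : t ≤ #Q) (htR : t ≤ #R) (hmax : #A ≤ max #Q #R)
    (hrep : ∀ a ∈ A, t ≤ repCount f Q R a) (hrich : ∀ s ∈ S, τ ≤ #(A ∩ B.image (g s)))
    (hpairs : #S * τ ≤ 2 * (#A * #B)) :
    #S * τ ^ 3 * t ^ 3 ≤ 100 * ((#Q : ℝ) ^ 2 * (#R : ℝ) ^ 2 * (#B : ℝ) ^ 2) := by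
  rcases le_max_iff.1 hmax with hAQ | hAR
  · exact hfg.card_mul_pow_three_le_of_card_le_left ht hτ htQ htR hAQ hrep hrich hpairs
  · have hflip : flip f = f := funext₂ fun q r => hf r q
    rw [mul_comm ((#Q : ℝ) ^ 2)]
    refine hfg.card_mul_pow_three_le_of_card_le_left ht hτ htR htQ hAR (fun a ha => ?_) hrich
      hpairs
    rw [← hflip, repCount_flip]
    exact hrep a ha

/-- The quotients `|Q|² |R|² / (|A| t³)` in the definitions of `d_*` and `d_+`, for a general
operation `f` in place of multiplication or addition. The condition `t ≤ min (|Q|, |R|)` follows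
there from `t ≤ repCount f Q R a`, because `f` is cancellative on `Q` and `R`. -/
def repValues (f : α → α → ε) (A : Finset ε) : Set ℝ :=
  {v | ∃ (t : ℝ) (Q R : Finset α), 0 < t ∧ t ≤ #Q ∧ t ≤ #R ∧ (∀ a ∈ A, t ≤ repCount f Q R a) ∧
    #A ≤ max #Q #R ∧ v = (#Q : ℝ) ^ 2 * (#R : ℝ) ^ 2 / (#A * t ^ 3)}

theorem one_le_of_mem_repValues {f : α → α → ε} {A : Finset ε} (hA : A.Nonempty) {v : ℝ}
    (hv : v ∈ repValues f A) : 1 ≤ v := by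
  obtain ⟨t, Q, R, ht, htQ, htR, -, hmax, rfl⟩ := hv
  have hA0 : (0 : ℝ) < #A := Nat.cast_pos.2 hA.card_pos
  have hmax' : (#A : ℝ) ≤ max (#Q : ℝ) (#R : ℝ) := by exact_mod_cast hmax
  rw [one_le_div (mul_pos hA0 (pow_pos ht 3))]
  rcases le_max_iff.1 hmax' with h | h
  · calc (#A : ℝ) * t ^ 3 = #A * t * t ^ 2 := by ring
      _ ≤ #Q * #Q * (#R : ℝ) ^ 2 := by gcongr
      _ = _ := by ring
  · calc (#A : ℝ) * t ^ 3 = #A * t * t ^ 2 := by ring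
      _ ≤ #R * #R * (#Q : ℝ) ^ 2 := by gcongr
      _ = _ := by ring

theorem HasSzTBound.card_le_of_mem_repValues {f : α → α → ε} (hfg : HasSzTBound f g)
    (hf : ∀ q r, f q r = f r q) {A : Finset ε} (hA : A.Nonempty) {v : ℝ} (hv : v ∈ repValues f A)
    {S : Finset γ} {B : Finset δ} {τ : ℝ} (hτ : 0 < τ) (hrich : ∀ s ∈ S, τ ≤ #(A ∩ B.image (g s)))
    (hpairs : #S * τ ≤ 2 * (#A * #B)) : #S ≤ 100 * v * #A * (#B : ℝ) ^ 2 / τ ^ 3 := by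
  obtain ⟨t, Q, R, ht, htQ, htR, hrep, hmax, rfl⟩ := hv
  have hA0 : (0 : ℝ) < #A := Nat.cast_pos.2 hA.card_pos
  have hbound := hfg.card_mul_pow_three_le hf ht hτ htQ htR hmax hrep hrich hpairs
  rw [le_div_iff₀ (by positivity)]
  calc (#S : ℝ) * τ ^ 3 ≤ 100 * ((#Q : ℝ) ^ 2 * (#R : ℝ) ^ 2 * (#B : ℝ) ^ 2) / t ^ 3 :=
        (le_div_iff₀ (by positivity)).2 hbound
    _ = _ := by field_simp [hA0.ne']

theorem le_mul_sInf {V : Set ℝ} (hV : V.Nonempty) {N κ : ℝ} (hκ : 0 ≤ κ)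
    (h : ∀ v ∈ V, N ≤ κ * v) : N ≤ κ * sInf V := by
  rw [← smul_eq_mul, ← Real.sInf_smul_of_nonneg hκ]
  refine le_csInf hV.smul_set ?_
  rintro _ ⟨v, hv, rfl⟩
  exact h v hv

theorem HasSzTBound.card_le_sInf {f : α → α → ε} (hfg : HasSzTBound f g)
    (hf : ∀ q r, f q r = f r q) {A : Finset ε} (hA : A.Nonempty) {V : Set ℝ} (hV : V.Nonempty)
    (hVA : V ⊆ repValues f A) {S : Finset γ} {B : Finset δ} {τ : ℝ} (hτ : 0 < τ)
    (hrich : ∀ s ∈ S, τ ≤ #(A ∩ B.image (g s))) (hpairs : #S * τ ≤ 2 * (#A * #B)) :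
    #S ≤ 100 * sInf V * #A * (#B : ℝ) ^ 2 / τ ^ 3 :=
  calc (#S : ℝ) ≤ 100 * #A * (#B : ℝ) ^ 2 / τ ^ 3 * sInf V :=
        le_mul_sInf hV (by positivity) fun v hv =>
          (hfg.card_le_of_mem_repValues hf hA (hVA hv) hτ hrich hpairs).trans_eq (by ring)
    _ = _ := by ring

end RichElements

section SymmetrySets

theorem card_inter_smul_inv {G : Type*} [GroupWithZero G] [DecidableEq G] {Q R : Finset G}
    (hQ : 0 ∉ Q) (hR : 0 ∉ R) (x : G) :
    #(Q ∩ x • R⁻¹) = repCount (fun q r : G => q * r) Q R x := by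
  have himage : x • R⁻¹ = R.image fun r => x * r⁻¹ := by
    rw [← image_inv_eq_inv, ← image_smul, image_image]
    rfl
  rw [himage]
  refine (repCount_eq_card_inter_image (fun q hq => ?_) fun q _ r hr => ?_).symm
  · exact (mul_right_injective₀ (ne_of_mem_of_not_mem hq hQ)).injOn
  · exact eq_comm.trans (mul_inv_eq_iff_eq_mul₀ (ne_of_mem_of_not_mem hr hR)).symm

theorem card_inter_singleton_sub {G : Type*} [AddGroup G] [DecidableEq G] (Q R : Finset G)
    (x : G) : #(Q ∩ ({x} - R)) = repCount (fun q r : G => q + r) Q R x := by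
  rw [singleton_sub]
  exact (repCount_eq_card_inter_image (fun q _ => (add_right_injective q).injOn)
    fun q _ r _ => eq_comm.trans sub_eq_iff_eq_add.symm).symm

theorem dMulValues_subset_repValues {A : Finset ℝ} (hA : A.Nonempty) :
    dMulValues A ⊆ repValues (fun q r : ℝ => q * r) A := by
  rintro v ⟨t, Q, R, ht, -, -, hQ, hR, hsym, hmax, rfl⟩
  have hrep : ∀ a ∈ A, t ≤ repCount (fun q r : ℝ => q * r) Q R a := fun a ha => by
    rw [← card_inter_smul_inv hQ hR]
    exact hsym ha
  obtain ⟨a, ha⟩ := hA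
  refine ⟨t, Q, R, ht, (hrep a ha).trans (Nat.cast_le.2 (repCount_le_card_left fun q hq => ?_)),
    (hrep a ha).trans (Nat.cast_le.2 (repCount_le_card_right fun r hr => ?_)), hrep, hmax, rfl⟩
  · exact (mul_right_injective₀ (ne_of_mem_of_not_mem hq hQ)).injOn
  · exact (mul_left_injective₀ (ne_of_mem_of_not_mem hr hR)).injOn

theorem dAddValues_subset_repValues {A : Finset ℝ} (hA : A.Nonempty) :
    dAddValues A ⊆ repValues (fun q r : ℝ => q + r) A := by
  rintro v ⟨t, Q, R, ht, -, -, -, -, hsym, hmax, rfl⟩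
  have hrep : ∀ a ∈ A, t ≤ repCount (fun q r : ℝ => q + r) Q R a := fun a ha => by
    rw [← card_inter_singleton_sub]
    exact hsym ha
  obtain ⟨a, ha⟩ := hA
  refine ⟨t, Q, R, ht, (hrep a ha).trans (Nat.cast_le.2 (repCount_le_card_left fun q _ => ?_)),
    (hrep a ha).trans (Nat.cast_le.2 (repCount_le_card_right fun r _ => ?_)), hrep, hmax, rfl⟩
  · exact (add_right_injective q).injOn
  · exact (add_left_injective r).injOn

theorem one_le_of_mem_dMulValues {A : Finset ℝ} (hA : A.Nonempty) {v : ℝ}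
    (hv : v ∈ dMulValues A) : 1 ≤ v :=
  one_le_of_mem_repValues hA (dMulValues_subset_repValues hA hv)

theorem one_le_of_mem_dAddValues {A : Finset ℝ} (hA : A.Nonempty) {v : ℝ}
    (hv : v ∈ dAddValues A) : 1 ≤ v :=
  one_le_of_mem_repValues hA (dAddValues_subset_repValues hA hv)

theorem isSzTAdd_dMul {A : Finset ℝ} (hA : A.Nonempty) (hV : (dMulValues A).Nonempty) :
    IsSzTAdd A (100 * dMul A) := by
  have hone : 1 ≤ dMul A := le_csInf hV fun v hv => one_le_of_mem_dMulValues hA hv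
  refine ⟨by positivity, fun B τ hτ => ?_⟩
  have hrich : ∀ s ∈ {s ∈ A - B | τ ≤ #(A ∩ (s +ᵥ B))}, τ ≤ #(A ∩ B.image (s + ·)) :=
    fun s hs => (mem_filter.1 hs).2
  refine hasSzTBound_mul_add.card_le_sInf mul_comm hA hV (dMulValues_subset_repValues hA)
    (zero_lt_one.trans_le hτ) hrich ?_
  have hpairs := card_mul_le_of_rich (fun b _ => (add_left_injective b).injOn) hrich
  nlinarith

theorem isSzTMul_dAdd {A : Finset ℝ} (hA : A.Nonempty) (hV : (dAddValues A).Nonempty) :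
    IsSzTMul A (100 * dAdd A) := by
  have hone : 1 ≤ dAdd A := le_csInf hV fun v hv => one_le_of_mem_dAddValues hA hv
  refine ⟨by positivity, fun B τ hτ => ?_⟩
  have hrich : ∀ s ∈ {s ∈ A * (B.erase 0)⁻¹ | τ ≤ #(A ∩ s • B)}, τ ≤ #(A ∩ B.image (s * ·)) :=
    fun s hs => (mem_filter.1 hs).2
  exact hasSzTBound_add_mul.card_le_sInf add_comm hA hV (dAddValues_subset_repValues hA)
    (zero_lt_one.trans_le hτ) hrich (card_mul_le_of_rich_dilates (filter_subset _ _) hrich)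

end SymmetrySets

section PopularLevel

theorem sum_eq_sum_card_le {ι : Type*} {A : Finset ι} {f : ι → ℕ} {N : ℕ}
    (hf : ∀ a ∈ A, f a ≤ N) : ∑ a ∈ A, f a = ∑ t ∈ Icc 1 N, #{a ∈ A | t ≤ f a} := by
  simp only [card_filter]
  rw [sum_comm]
  refine sum_congr rfl fun a ha => ?_
  have hlevels : {t ∈ Icc 1 N | t ≤ f a} = Icc 1 (f a) := by
    ext t
    have := hf a ha
    simp only [mem_filter, mem_Icc]
    omega
  rw [← card_filter, hlevels, Nat.card_Icc, Nat.add_sub_cancel]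

theorem exists_sum_le_harmonic_mul {ι : Type*} {A : Finset ι} {f : ι → ℕ} {N : ℕ} (hN : 0 < N)
    (hf : ∀ a ∈ A, f a ≤ N) :
    ∃ t : ℕ, 0 < t ∧ ((∑ a ∈ A, f a : ℕ) : ℚ) ≤ harmonic N * (t * #{a ∈ A | t ≤ f a}) := by
  have hsum : ∑ t ∈ Icc 1 N, ((∑ a ∈ A, f a : ℕ) : ℚ) * (t : ℚ)⁻¹ ≤
      ∑ t ∈ Icc 1 N, harmonic N * (#{a ∈ A | t ≤ f a} : ℚ) := by
    rw [← mul_sum, ← mul_sum, ← harmonic_eq_sum_Icc, sum_eq_sum_card_le hf, Nat.cast_sum,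
      mul_comm]
  obtain ⟨t, ht, hle⟩ := exists_le_of_sum_le (nonempty_Icc.2 hN) hsum
  have ht0 : 0 < t := (mem_Icc.1 ht).1
  refine ⟨t, ht0, ?_⟩
  rw [← div_eq_mul_inv, div_le_iff₀ (Nat.cast_pos.2 ht0)] at hle
  linarith

theorem one_le_two_mul_log {x : ℝ} (hx : 2 ≤ x) : 1 ≤ 2 * Real.log x := by
  linarith [Real.log_le_log two_pos hx, Real.log_two_gt_d9]

theorem harmonic_le_three_mul_log {n : ℕ} (hn : 2 ≤ n) : (harmonic n : ℝ) ≤ 3 * Real.log n := by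
  linarith [harmonic_le_one_add_log n, one_le_two_mul_log (Nat.ofNat_le_cast.2 hn)]

theorem exists_popular_subset {α β : Type*} [DecidableEq β] {f : α → β → β} {A : Finset β}
    {P : Finset α} (hA : 2 ≤ #A) (hf : ∀ x ∈ P, Set.InjOn (f x) A)
    (hf' : ∀ a ∈ A, Set.InjOn (f · a) P) (hpos : 0 < ∑ a ∈ A, repCount f P A a) :
    ∃ A' ⊆ A, A'.Nonempty ∧ ∃ t : ℕ, 0 < t ∧ t ≤ #P ∧ (∀ a ∈ A', t ≤ repCount f P A a) ∧
      ((∑ a ∈ A, repCount f P A a : ℕ) : ℝ) ≤ 3 * Real.log #A * (t * #A') := by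
  obtain ⟨t, ht, hlevel⟩ := exists_sum_le_harmonic_mul (f := repCount f P A)
    (zero_lt_two.trans_le hA) fun a _ => repCount_le_card_right hf'
  have hrep : ∀ a ∈ ({a ∈ A | t ≤ repCount f P A a} : Finset β), t ≤ repCount f P A a :=
    fun a ha => (mem_filter.1 ha).2
  have hne : ({a ∈ A | t ≤ repCount f P A a} : Finset β).Nonempty := by
    rw [nonempty_iff_ne_empty]
    intro hempty
    rw [hempty, card_empty, Nat.cast_zero, mul_zero, mul_zero] at hlevel
    exact hpos.not_ge (by exact_mod_cast hlevel)
  obtain ⟨a, ha⟩ := hne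
  refine ⟨_, filter_subset _ _, ⟨a, ha⟩, t, ht,
    (hrep a ha).trans (repCount_le_card_left hf), hrep, ?_⟩
  calc ((∑ a ∈ A, repCount f P A a : ℕ) : ℝ)
    _ ≤ harmonic #A * (t * #{a ∈ A | t ≤ repCount f P A a}) := by exact_mod_cast hlevel
    _ ≤ _ := by gcongr; exact harmonic_le_three_mul_log hA

theorem popular_level_bounds {σ ℓ t a p p' n : ℝ} (hσ : 0 < σ) (hℓ : 1 ≤ 2 * ℓ) (ht : 0 < t)
    (ha : 0 < a) (htp : t ≤ p') (hp : p' ≤ p) (h : σ ≤ 3 * ℓ * (t * a)) :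
    p' ^ 2 * n ^ 2 / (a * t ^ 3) ≤ 100 * ℓ ^ 3 * (p ^ 2 * n ^ 2 * a ^ 2 / σ ^ 3) ∧
      σ / p ≤ 100 * ℓ ^ 3 * a := by
  have hℓ0 : 0 < ℓ := by linarith
  have hp' : 0 < p' := ht.trans_le htp
  have hp0 : 0 < p := hp'.trans_le hp
  constructor
  · rw [← mul_div_assoc, div_le_div_iff₀ (by positivity) (by positivity)]
    calc p' ^ 2 * n ^ 2 * σ ^ 3 ≤ p ^ 2 * n ^ 2 * (3 * ℓ * (t * a)) ^ 3 := by gcongr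
      _ = 27 * (ℓ ^ 3 * (p ^ 2 * n ^ 2 * a ^ 2) * (a * t ^ 3)) := by ring
      _ ≤ 100 * (ℓ ^ 3 * (p ^ 2 * n ^ 2 * a ^ 2) * (a * t ^ 3)) := by gcongr; norm_num
      _ = _ := by ring
  · rw [div_le_iff₀ hp0]
    calc σ ≤ 3 * ℓ * (t * a) := h
      _ ≤ 3 * ℓ * (p * a) := by gcongr; exact htp.trans hp
      _ = 3 * (ℓ * a * p) * 1 ^ 2 := by ring
      _ ≤ 3 * (ℓ * a * p) * (2 * ℓ) ^ 2 := by gcongr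
      _ = 12 * (ℓ ^ 3 * a * p) := by ring
      _ ≤ 100 * (ℓ ^ 3 * a * p) := by gcongr; norm_num
      _ = _ := by ring

end PopularLevel

theorem sigmaMul_eq_sum_repCount {A : Finset ℝ} (P : Finset ℝ) (hA : 0 ∉ A) :
    sigmaMul A P = ∑ a ∈ A, repCount (fun x a : ℝ => x * a) (P.erase 0) A a := by
  rw [← sum_card_inter_image_eq_sum_repCount fun x hx =>
    (mul_right_injective₀ (ne_of_mem_erase hx)).injOn, sigmaMul, ← sum_erase P (a := 0)]
  · rfl
  · rw [card_eq_zero, ← disjoint_iff_inter_eq_empty]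
    exact (disjoint_singleton_right.2 hA).mono_right (zero_smul_finset_subset A)

theorem sigmaAdd_eq_sum_repCount (A P : Finset ℝ) :
    sigmaAdd A P = ∑ a ∈ A, repCount (fun x a : ℝ => x + a) P A a :=
  sum_card_inter_image_eq_sum_repCount fun x _ => (add_right_injective x).injOn

theorem exists_zero_notMem_vadd_and_neg_vadd {G : Type*} [AddGroup G] [Infinite G]
    [DecidableEq G] (P A : Finset G) : ∃ u : G, 0 ∉ u +ᵥ P ∧ 0 ∉ -u +ᵥ A := by
  obtain ⟨u, hu⟩ := Infinite.exists_notMem_finset (-P ∪ A)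
  refine ⟨u, ?_⟩
  simpa [← neg_vadd_mem_iff] using hu

theorem repCount_vadd_neg_vadd {G : Type*} [AddCommGroup G] [DecidableEq G] (P A : Finset G)
    (u a : G) :
    repCount (fun x y : G => x + y) (u +ᵥ P) (-u +ᵥ A) a =
      repCount (fun x y : G => x + y) P A a :=
  repCount_image (add_right_injective u) (add_right_injective (-u))
    (fun x y => by abel) P A

theorem exists_subset_isSzTAdd_dMul {A P : Finset ℝ} (hcard : 2 ≤ #A) (h0 : 0 ∉ A)
    (hpos : 0 < sigmaMul A P) :
    ∃ A' ⊆ A, IsSzTAdd A' (100 * dMul A') ∧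
      dMul A' ≤ 100 * Real.log #A ^ 3 *
        ((#P : ℝ) ^ 2 * (#A : ℝ) ^ 2 * (#A' : ℝ) ^ 2 / (sigmaMul A P : ℝ) ^ 3) ∧
      (sigmaMul A P : ℝ) / #P ≤ 100 * Real.log #A ^ 3 * #A' := by
  have hσ := sigmaMul_eq_sum_repCount P h0
  obtain ⟨A', hsub, hne, t, ht, htP, hrep, hlevel⟩ := exists_popular_subset hcard
    (fun x hx => (mul_right_injective₀ (ne_of_mem_erase hx)).injOn)
    (fun a ha => (mul_left_injective₀ (ne_of_mem_of_not_mem ha h0)).injOn) (hσ ▸ hpos)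
  rw [← hσ] at hlevel
  have hmem : (#(P.erase 0) : ℝ) ^ 2 * (#A : ℝ) ^ 2 / (#A' * (t : ℝ) ^ 3) ∈ dMulValues A' := by
    refine ⟨t, P.erase 0, A, Nat.cast_pos.2 ht, card_pos.1 (ht.trans_le htP), hne.mono hsub,
      notMem_erase 0 P, h0, fun a ha => ?_, (card_le_card hsub).trans (le_max_right _ _), rfl⟩
    rw [symMul, Set.mem_ofPred_eq, card_inter_smul_inv (notMem_erase 0 P) h0]
    exact Nat.cast_le.2 (hrep a ha)
  obtain ⟨hquot, hcard'⟩ := popular_level_bounds (n := #A) (Nat.cast_pos.2 hpos)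
    (one_le_two_mul_log (Nat.ofNat_le_cast.2 hcard)) (Nat.cast_pos.2 ht)
    (Nat.cast_pos.2 hne.card_pos) (Nat.cast_le.2 htP)
    (Nat.cast_le.2 (card_le_card (erase_subset 0 P))) hlevel
  exact ⟨A', hsub, isSzTAdd_dMul hne ⟨_, hmem⟩,
    (csInf_le ⟨1, fun _ => one_le_of_mem_dMulValues hne⟩ hmem).trans hquot, hcard'⟩

theorem exists_subset_isSzTMul_dAdd {A P : Finset ℝ} (hcard : 2 ≤ #A)
    (hpos : 0 < sigmaAdd A P) :
    ∃ A' ⊆ A, IsSzTMul A' (100 * dAdd A') ∧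
      dAdd A' ≤ 100 * Real.log #A ^ 3 *
        ((#P : ℝ) ^ 2 * (#A : ℝ) ^ 2 * (#A' : ℝ) ^ 2 / (sigmaAdd A P : ℝ) ^ 3) ∧
      (sigmaAdd A P : ℝ) / #P ≤ 100 * Real.log #A ^ 3 * #A' := by
  have hσ := sigmaAdd_eq_sum_repCount A P
  obtain ⟨A', hsub, hne, t, ht, htP, hrep, hlevel⟩ := exists_popular_subset hcard
    (fun x _ => (add_right_injective x).injOn) (fun a _ => (add_left_injective a).injOn)
    (hσ ▸ hpos)
  rw [← hσ] at hlevel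
  -- `P` and `A` may contain `0`, but translating them in opposite directions preserves all sums.
  have hmem : (#P : ℝ) ^ 2 * (#A : ℝ) ^ 2 / (#A' * (t : ℝ) ^ 3) ∈ dAddValues A' := by
    obtain ⟨u, huP, huA⟩ := exists_zero_notMem_vadd_and_neg_vadd P A
    refine ⟨t, u +ᵥ P, -u +ᵥ A, Nat.cast_pos.2 ht, (card_pos.1 (ht.trans_le htP)).vadd_finset,
      (hne.mono hsub).vadd_finset, huP, huA, fun a ha => ?_, ?_, ?_⟩
    · rw [symAdd, Set.mem_ofPred_eq, card_inter_singleton_sub, repCount_vadd_neg_vadd]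
      exact Nat.cast_le.2 (hrep a ha)
    · rw [card_vadd_finset, card_vadd_finset]
      exact (card_le_card hsub).trans (le_max_right _ _)
    · rw [card_vadd_finset, card_vadd_finset]
  obtain ⟨hquot, hcard'⟩ := popular_level_bounds (n := #A) (Nat.cast_pos.2 hpos)
    (one_le_two_mul_log (Nat.ofNat_le_cast.2 hcard)) (Nat.cast_pos.2 ht)
    (Nat.cast_pos.2 hne.card_pos) (Nat.cast_le.2 htP) le_rfl hlevel
  exact ⟨A', hsub, isSzTMul_dAdd hne ⟨_, hmem⟩,
    (csInf_le ⟨1, fun _ => one_le_of_mem_dAddValues hne⟩ hmem).trans hquot, hcard'⟩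

end SumProduct

theorem lemma19 :
    ∃ C c : ℝ, 0 < C ∧ 0 < c ∧ ∀ A P : Finset ℝ, 2 ≤ A.card →
      (0 ∉ A → 0 < SumProduct.sigmaMul A P →
        ∃ A' : Finset ℝ, A' ⊆ A ∧
          SumProduct.IsSzTAdd A' (C * SumProduct.dMul A') ∧
          SumProduct.dMul A' ≤ C * Real.log (A.card : ℝ) ^ c *
            ((P.card : ℝ) ^ 2 * (A.card : ℝ) ^ 2 * (A'.card : ℝ) ^ 2 /
              (SumProduct.sigmaMul A P : ℝ) ^ 3) ∧
          (SumProduct.sigmaMul A P : ℝ) / (P.card : ℝ) ≤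
            C * Real.log (A.card : ℝ) ^ c * (A'.card : ℝ)) ∧
      (0 < SumProduct.sigmaAdd A P →
        ∃ A'' : Finset ℝ, A'' ⊆ A ∧
          SumProduct.IsSzTMul A'' (C * SumProduct.dAdd A'') ∧
          SumProduct.dAdd A'' ≤ C * Real.log (A.card : ℝ) ^ c *
            ((P.card : ℝ) ^ 2 * (A.card : ℝ) ^ 2 * (A''.card : ℝ) ^ 2 /
              (SumProduct.sigmaAdd A P : ℝ) ^ 3) ∧
          (SumProduct.sigmaAdd A P : ℝ) / (P.card : ℝ) ≤
            C * Real.log (A.card : ℝ) ^ c * (A''.card : ℝ)) := by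
  refine ⟨100, 3, by norm_num, by norm_num, fun A P hcard => ?_⟩
  simp only [Real.rpow_ofNat]
  exact ⟨SumProduct.exists_subset_isSzTAdd_dMul hcard,
    SumProduct.exists_subset_isSzTMul_dAdd hcard⟩
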